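/- Let $k$ be a field of characteristic zero and let $P$ be a (symmetric, unital) dg operad over $k$, with arities $n\ge 0$, cohomologically $\mathbb{Z}$-graded (differential of degree $+1$, no boundedness or finiteness assumption). Let $H(P)$ be its cohomology, an operad in graded vector spaces, and assume that $H(P)(0)=0$ and $H(P)(1)\cong k$ (concentrated in degree $0$). For $q\in k^\times$ let $\phi_q$ be the grading automorphism of $H(P)$, that is, the automorphism which is multiplication by $q^i$ on the degree $i$ part $H^i(P)(n)$ for all $n$ and $i$. Suppose that for some $q\in k^\times$ that is not a root of unity, $\phi_q$ lifts to $P$: there is an automorphism $\sigma$ of the dg operad $P$ with $H(\sigma)=\phi_q$. Then $P$ is formal, i.e. $P$ and $H(P)$ (regarded as a dg operad with zero differential) are connected by a finite chain of quasi-isomorphisms of dg operads. -/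

import Mathlib

open CategoryTheory

universe v u

namespace Operadic

/-! ### Inputs of a partial composition -/

/-- The labelling of the `p = m + n - 1` inputs of a partial composition `f ∘ₐ g`, where `f` has
`m` inputs and `g` has `n` inputs: the inputs of `g` are put, in order, in the place of the
input `a` of `f`. -/
def insertFun {m n p : ℕ} (h : m + n = p + 1) (a : Fin m) :
    {x : Fin m // x ≠ a} ⊕ Fin n → Fin p
  | .inl x => if hx : x.1.1 < a.1 then ⟨x.1.1, by omega⟩
      else ⟨x.1.1 + n - 1, by
        have h1 := x.1.2
        have h2 : x.1.1 ≠ a.1 := fun e => x.2 (Fin.ext e)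
        omega⟩
  | .inr y => ⟨a.1 + y.1, by omega⟩

theorem insertFun_bijective {m n p : ℕ} (h : m + n = p + 1) (a : Fin m) :
    Function.Bijective (insertFun h a) := by
  rw [Fintype.bijective_iff_injective_and_card]
  constructor
  · rintro (⟨x, hx⟩ | y) (⟨x', hx'⟩ | y') e
    · have h1 : x.1 ≠ a.1 := fun e => hx (Fin.ext e)
      have h2 : x'.1 ≠ a.1 := fun e => hx' (Fin.ext e)
      simp only [insertFun] at e
      congr 2
      split_ifs at e <;> simp only [Fin.mk.injEq] at e <;> apply Fin.ext <;> omega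
    · have h1 : x.1 ≠ a.1 := fun e => hx (Fin.ext e)
      simp only [insertFun] at e
      split_ifs at e <;> simp only [Fin.mk.injEq] at e <;> omega
    · have h2 : x'.1 ≠ a.1 := fun e => hx' (Fin.ext e)
      simp only [insertFun] at e
      split_ifs at e <;> simp only [Fin.mk.injEq] at e <;> omega
    · simp only [insertFun, Fin.mk.injEq] at e
      congr 1
      apply Fin.ext
      omega
  · have := a.2
    simp only [Fintype.card_sum, Fintype.card_subtype_compl, Fintype.card_fin,
      Fintype.card_unique]
    omega

/-- The bijection between the inputs of `f` other than `a` together with the inputs of `g`, and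
the inputs of `f ∘ₐ g`. -/
noncomputable def insertEquiv {m n p : ℕ} (h : m + n = p + 1) (a : Fin m) :
    {x : Fin m // x ≠ a} ⊕ Fin n ≃ Fin p :=
  Equiv.ofBijective (insertFun h a) (insertFun_bijective h a)

/-- The permutation `σ ∘ₐ τ` of the inputs of `f ∘ₐ g` induced by a permutation `σ` of the inputs
of `f` and a permutation `τ` of the inputs of `g`. -/
noncomputable def blockPerm {m n p : ℕ} (h : m + n = p + 1) (a : Fin m)
    (σ : Equiv.Perm (Fin m)) (τ : Equiv.Perm (Fin n)) : Equiv.Perm (Fin p) :=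
  (insertEquiv h a).symm.trans
    ((Equiv.sumCongr (σ.subtypeEquiv (p := fun x => x ≠ a) (q := fun x => x ≠ σ a)
    fun _ => σ.injective.ne_iff.symm) τ).trans
      (insertEquiv h (σ a)))

/-! ### Operads in graded vector spaces -/

/-- A (symmetric, unital) operad in `ℤ`-graded vector spaces over `k`, with arities `n ≥ 0`,
given by partial compositions. The degree `i` part of the arity `n` component is `X n i`.

The action is a left action: the input `x` of `f` is the input `σ x` of `act σ f` (so that the
usual right action is `f · σ = act σ⁻¹ f`). The composition `f ∘ₐ g` of `f` of arity `m` and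
degree `i` with `g` of arity `n` and degree `j` is `comp hp hd a f g`; its arity
`p = m + n - 1` and its degree `l = i + j` are specified by the equations `hp` and `hd`. -/
structure GradedOperad (k : Type u) [Field k] where
  X : ℕ → ℤ → Type v
  [addCommGroup : ∀ n i, AddCommGroup (X n i)]
  [module : ∀ n i, Module k (X n i)]
  act : ∀ {n : ℕ} {i : ℤ}, Equiv.Perm (Fin n) → X n i →ₗ[k] X n i
  act_one : ∀ {n : ℕ} {i : ℤ} (x : X n i), act 1 x = x
  act_mul : ∀ {n : ℕ} {i : ℤ} (σ τ : Equiv.Perm (Fin n)) (x : X n i),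
    act (σ * τ) x = act σ (act τ x)
  one : X 1 0
  comp : ∀ {m n p : ℕ} {i j l : ℤ}, m + n = p + 1 → i + j = l → Fin m →
    X m i →ₗ[k] X n j →ₗ[k] X p l
  one_comp : ∀ {n : ℕ} {j : ℤ} (hp : 1 + n = n + 1) (hd : 0 + j = j) (a : Fin 1) (g : X n j),
    comp hp hd a one g = g
  comp_one : ∀ {m : ℕ} {i : ℤ} (hp : m + 1 = m + 1) (hd : i + 0 = i) (a : Fin m) (f : X m i),
    comp hp hd a f one = f
  /-- Sequential associativity: `(f ∘ₐ g) ∘_{a+b} h = f ∘ₐ (g ∘_b h)`. -/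
  comp_assoc : ∀ {m n r p q s : ℕ} {i j l ij jl t : ℤ}
    (hp : m + n = p + 1) (hs : p + r = s + 1) (hq : n + r = q + 1) (hs' : m + q = s + 1)
    (hij : i + j = ij) (ht : ij + l = t) (hjl : j + l = jl) (ht' : i + jl = t)
    (a : Fin m) (b : Fin n) (c : Fin p) (_ : c.1 = a.1 + b.1)
    (f : X m i) (g : X n j) (h : X r l),
    comp hs ht c (comp hp hij a f g) h = comp hs' ht' a f (comp hq hjl b g h)
  /-- Parallel associativity: `(f ∘ₐ g) ∘_{b+n-1} h = (-1)^{|g||h|} (f ∘_b h) ∘ₐ g` for `a < b`,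
  where `n` is the arity of `g`. -/
  comp_comm : ∀ {m n r p q s : ℕ} {i j l ij il t : ℤ}
    (hp : m + n = p + 1) (hs : p + r = s + 1) (hq : m + r = q + 1) (hs' : q + n = s + 1)
    (hij : i + j = ij) (ht : ij + l = t) (hil : i + l = il) (ht' : il + j = t)
    (a b : Fin m) (_ : a < b) (b' : Fin p) (_ : b'.1 + 1 = b.1 + n)
    (a' : Fin q) (_ : a'.1 = a.1)
    (f : X m i) (g : X n j) (h : X r l),
    comp hs ht b' (comp hp hij a f g) h =
      (j * l).negOnePow • comp hs' ht' a' (comp hq hil b f h) g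
  comp_act : ∀ {m n p : ℕ} {i j l : ℤ} (hp : m + n = p + 1) (hd : i + j = l) (a : Fin m)
    (σ : Equiv.Perm (Fin m)) (τ : Equiv.Perm (Fin n)) (f : X m i) (g : X n j),
    comp hp hd (σ a) (act σ f) (act τ g) = act (blockPerm hp a σ τ) (comp hp hd a f g)

attribute [instance] GradedOperad.addCommGroup GradedOperad.module

variable {k : Type u} [Field k]

namespace GradedOperad

/-- Morphisms of operads in graded vector spaces (of degree zero). -/
@[ext]
structure Hom (P Q : GradedOperad.{v} k) where
  map : ∀ n i, P.X n i →ₗ[k] Q.X n i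
  map_act : ∀ {n : ℕ} {i : ℤ} (σ : Equiv.Perm (Fin n)) (x : P.X n i),
    map n i (P.act σ x) = Q.act σ (map n i x)
  map_one : map 1 0 P.one = Q.one
  map_comp : ∀ {m n p : ℕ} {i j l : ℤ} (hp : m + n = p + 1) (hd : i + j = l) (a : Fin m)
    (f : P.X m i) (g : P.X n j),
    map p l (P.comp hp hd a f g) = Q.comp hp hd a (map m i f) (map n j g)

instance : Category (GradedOperad.{v} k) where
  Hom P Q := Hom P Q
  id P :=
    { map := fun _ _ => LinearMap.id
      map_act := fun _ _ => rfl
      map_one := rfl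
      map_comp := fun _ _ _ _ _ => rfl }
  comp f g :=
    { map := fun n i => g.map n i ∘ₗ f.map n i
      map_act := fun σ x => by simp [f.map_act, g.map_act]
      map_one := by simp [f.map_one, g.map_one]
      map_comp := fun hp hd a x y => by simp [f.map_comp, g.map_comp] }

/-- The endomorphism of an operad in graded vector spaces that is multiplication by `q ^ i` in
degree `i`. -/
def gradingHom (P : GradedOperad.{v} k) (q : kˣ) : P ⟶ P :=
  Hom.mk
    (fun _ i => ((q ^ i : kˣ) : k) • LinearMap.id)
    (fun σ x => by simp)
    (by simp)
    (fun hp hd a f g => by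
      subst hd
      simp [zpow_add, smul_smul, mul_comm])

/-- The grading automorphism `φ_q` of an operad in graded vector spaces: multiplication by
`q ^ i` in degree `i`. -/
def gradingAut (P : GradedOperad.{v} k) (q : kˣ) : P ≅ P where
  hom := P.gradingHom q
  inv := P.gradingHom q⁻¹
  hom_inv_id := by
    apply Hom.ext
    funext n i
    ext x
    change ((q⁻¹ ^ i : kˣ) : k) • (((q ^ i : kˣ) : k) • x) = x
    rw [smul_smul, ← Units.val_mul, ← mul_zpow]
    simp
  inv_hom_id := by
    apply Hom.ext
    funext n i
    ext x
    change ((q ^ i : kˣ) : k) • (((q⁻¹ ^ i : kˣ) : k) • x) = x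
    rw [smul_smul, ← Units.val_mul, ← mul_zpow]
    simp

end GradedOperad

/-! ### Dg operads -/

/-- A dg operad over `k`, cohomologically graded: an operad in graded vector spaces with a
differential of degree `+1` that is compatible with all the structure. -/
structure DGOperad (k : Type u) [Field k] extends GradedOperad.{v} k where
  d : ∀ {n : ℕ} {i j : ℤ}, i + 1 = j → X n i →ₗ[k] X n j
  d_d : ∀ {n : ℕ} {i j l : ℤ} (h : i + 1 = j) (h' : j + 1 = l) (x : X n i), d h' (d h x) = 0
  d_act : ∀ {n : ℕ} {i j : ℤ} (h : i + 1 = j) (σ : Equiv.Perm (Fin n)) (x : X n i),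
    d h (act σ x) = act σ (d h x)
  d_one : ∀ {j : ℤ} (h : 0 + 1 = j), d h one = 0
  /-- The Leibniz rule `d (f ∘ₐ g) = d f ∘ₐ g + (-1)^{|f|} f ∘ₐ d g`. -/
  d_comp : ∀ {m n p : ℕ} {i i' j j' l l' : ℤ} (hp : m + n = p + 1) (hd : i + j = l)
    (hi : i + 1 = i') (hj : j + 1 = j') (hl : l + 1 = l') (h₁ : i' + j = l') (h₂ : i + j' = l')
    (a : Fin m) (f : X m i) (g : X n j),
    d hl (comp hp hd a f g) =
      comp hp h₁ a (d hi f) g + i.negOnePow • comp hp h₂ a f (d hj g)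

namespace DGOperad

/-- Morphisms of dg operads. -/
@[ext]
structure Hom (P Q : DGOperad.{v} k) extends
    GradedOperad.Hom P.toGradedOperad Q.toGradedOperad where
  map_d : ∀ {n : ℕ} {i j : ℤ} (h : i + 1 = j) (x : P.X n i),
    map n j (P.d h x) = Q.d h (map n i x)

instance : Category (DGOperad.{v} k) where
  Hom P Q := Hom P Q
  id P :=
    { map := fun _ _ => LinearMap.id
      map_act := fun _ _ => rfl
      map_one := rfl
      map_comp := fun _ _ _ _ _ => rfl
      map_d := fun _ _ => rfl }
  comp f g :=
    { map := fun n i => g.map n i ∘ₗ f.map n i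
      map_act := fun σ x => by simp [f.map_act, g.map_act]
      map_one := by simp [f.map_one, g.map_one]
      map_comp := fun hp hd a x y => by simp [f.map_comp, g.map_comp]
      map_d := fun h x => by simp [f.map_d, g.map_d] }

/-! ### The homology operad -/

section Homology

variable (P : DGOperad.{v} k)

/-- Cocycles of degree `i` in arity `n`. -/
def cycles (n : ℕ) (i : ℤ) : Submodule k (P.X n i) :=
  LinearMap.ker (P.d (n := n) (i := i) rfl)

/-- Coboundaries of degree `i` in arity `n`. -/
def boundaries (n : ℕ) (i : ℤ) : Submodule k (P.X n i) :=
  LinearMap.range (P.d (n := n) (sub_add_cancel i 1))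

variable {P}

theorem mem_cycles {n : ℕ} {i j : ℤ} (h : i + 1 = j) {x : P.X n i} :
    x ∈ P.cycles n i ↔ P.d h x = 0 := by
  subst h; rfl

theorem mem_boundaries {n : ℕ} {i j : ℤ} (h : j + 1 = i) {x : P.X n i} :
    x ∈ P.boundaries n i ↔ ∃ y : P.X n j, P.d h y = x := by
  obtain rfl : j = i - 1 := by omega
  rfl

theorem d_mem_boundaries {n : ℕ} {i j : ℤ} (h : j + 1 = i) (y : P.X n j) :
    P.d h y ∈ P.boundaries n i := (mem_boundaries h).2 ⟨y, rfl⟩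

theorem act_mem_cycles {n : ℕ} {i : ℤ} (σ : Equiv.Perm (Fin n)) {x : P.X n i}
    (hx : x ∈ P.cycles n i) : P.act σ x ∈ P.cycles n i := by
  rw [mem_cycles rfl] at hx ⊢
  rw [P.d_act, hx, map_zero]

theorem act_mem_boundaries {n : ℕ} {i : ℤ} (σ : Equiv.Perm (Fin n)) {x : P.X n i}
    (hx : x ∈ P.boundaries n i) : P.act σ x ∈ P.boundaries n i := by
  obtain ⟨y, rfl⟩ := hx
  rw [← P.d_act]
  exact d_mem_boundaries _ _

theorem comp_mem_cycles {m n p : ℕ} {i j l : ℤ} (hp : m + n = p + 1) (hd : i + j = l) (a : Fin m)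
    {f : P.X m i} {g : P.X n j} (hf : f ∈ P.cycles m i) (hg : g ∈ P.cycles n j) :
    P.comp hp hd a f g ∈ P.cycles p l := by
  rw [mem_cycles rfl] at hf hg ⊢
  rw [P.d_comp hp hd rfl rfl rfl (by omega) (by omega), hf, hg]
  simp

theorem comp_mem_boundaries_left {m n p : ℕ} {i j l : ℤ} (hp : m + n = p + 1) (hd : i + j = l)
    (a : Fin m) {f : P.X m i} {g : P.X n j} (hf : f ∈ P.boundaries m i)
    (hg : g ∈ P.cycles n j) : P.comp hp hd a f g ∈ P.boundaries p l := by
  obtain ⟨y, rfl⟩ := hf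
  rw [mem_cycles rfl] at hg
  have := P.d_comp hp (i := i - 1) (j := j) (l := l - 1) (by omega) (sub_add_cancel i 1) rfl
    (sub_add_cancel l 1) hd (by omega) a y g
  rw [hg, map_zero, smul_zero, add_zero] at this
  rw [← this]
  exact d_mem_boundaries _ _

theorem comp_mem_boundaries_right {m n p : ℕ} {i j l : ℤ} (hp : m + n = p + 1) (hd : i + j = l)
    (a : Fin m) {f : P.X m i} {g : P.X n j} (hf : f ∈ P.cycles m i)
    (hg : g ∈ P.boundaries n j) : P.comp hp hd a f g ∈ P.boundaries p l := by
  obtain ⟨y, rfl⟩ := hg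
  rw [mem_cycles rfl] at hf
  have := P.d_comp hp (i := i) (j := j - 1) (l := l - 1) (by omega) rfl (sub_add_cancel j 1)
    (sub_add_cancel l 1) (by omega) hd a f y
  rw [hf, map_zero, LinearMap.zero_apply, zero_add] at this
  have h2 : P.comp hp hd a f (P.d (sub_add_cancel j 1) y) =
      i.negOnePow • P.d (sub_add_cancel l 1)
        (P.comp (l := l - 1) hp (by omega) a f y) := by
    rw [this, smul_smul, ← Int.negOnePow_add, Int.negOnePow_even _ ⟨i, rfl⟩, one_smul]
  rw [h2, Units.smul_def]
  exact zsmul_mem (d_mem_boundaries _ _) _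

variable (P)

/-- The cohomology of degree `i` in arity `n`: cocycles modulo coboundaries. -/
abbrev H (n : ℕ) (i : ℤ) : Type v :=
  P.cycles n i ⧸ (P.boundaries n i).submoduleOf (P.cycles n i)

variable {P}

/-- The class of a cocycle. -/
abbrev H.mk {n : ℕ} {i : ℤ} : P.cycles n i →ₗ[k] P.H n i :=
  ((P.boundaries n i).submoduleOf (P.cycles n i)).mkQ

theorem H.ind {n : ℕ} {i : ℤ} {motive : P.H n i → Prop}
    (h : ∀ x : P.cycles n i, motive (H.mk x)) (x : P.H n i) : motive x :=
  (Submodule.mkQ_surjective _ x).elim fun y hy => hy ▸ h y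

variable (P)

/-- The action of the symmetric group on cohomology. -/
def actH {n : ℕ} {i : ℤ} (σ : Equiv.Perm (Fin n)) : P.H n i →ₗ[k] P.H n i :=
  Submodule.mapQ _ _ ((P.act σ).restrict fun _ hx => act_mem_cycles σ hx)
    fun _ hx => act_mem_boundaries σ hx

/-- Partial composition of cocycles. -/
def compCycles {m n p : ℕ} {i j l : ℤ} (hp : m + n = p + 1) (hd : i + j = l) (a : Fin m) :
    P.cycles m i →ₗ[k] P.cycles n j →ₗ[k] P.cycles p l :=
  LinearMap.mk₂ k (fun f g => ⟨P.comp hp hd a f.1 g.1, comp_mem_cycles hp hd a f.2 g.2⟩)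
    (fun _ _ _ => Subtype.ext (by simp)) (fun _ _ _ => Subtype.ext (by simp))
    (fun _ _ _ => Subtype.ext (by simp)) (fun _ _ _ => Subtype.ext (by simp))

/-- Partial composition of cohomology classes. -/
def compH {m n p : ℕ} {i j l : ℤ} (hp : m + n = p + 1) (hd : i + j = l) (a : Fin m) :
    P.H m i →ₗ[k] P.H n j →ₗ[k] P.H p l :=
  Submodule.liftQ _
    (LinearMap.flip (Submodule.liftQ _ (LinearMap.flip ((P.compCycles hp hd a).compr₂ H.mk))
      (fun g hg => by
        rw [LinearMap.mem_ker]
        ext f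
        exact (Submodule.Quotient.mk_eq_zero _).2 (comp_mem_boundaries_right hp hd a f.2 hg))))
    (fun f hf => by
      rw [LinearMap.mem_ker]
      ext g
      exact (Submodule.Quotient.mk_eq_zero _).2 (comp_mem_boundaries_left hp hd a hf g.2))

theorem actH_mk {n : ℕ} {i : ℤ} (σ : Equiv.Perm (Fin n)) (x : P.cycles n i) :
    P.actH σ (H.mk x) = H.mk ⟨P.act σ x.1, act_mem_cycles σ x.2⟩ := rfl

theorem compH_mk {m n p : ℕ} {i j l : ℤ} (hp : m + n = p + 1) (hd : i + j = l) (a : Fin m)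
    (f : P.cycles m i) (g : P.cycles n j) :
    P.compH hp hd a (H.mk f) (H.mk g) =
      H.mk ⟨P.comp hp hd a f.1 g.1, comp_mem_cycles hp hd a f.2 g.2⟩ := rfl

/-- The cohomology operad `H(P)` of a dg operad `P`. -/
def homology : GradedOperad.{v} k where
  X n i := P.H n i
  act σ := P.actH σ
  act_one x := by
    induction x using H.ind with | h x =>
    rw [actH_mk]
    exact congrArg _ (Subtype.ext (P.act_one _))
  act_mul σ τ x := by
    induction x using H.ind with | h x =>
    rw [actH_mk, actH_mk, actH_mk]
    exact congrArg _ (Subtype.ext (P.act_mul _ _ _))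
  one := H.mk ⟨P.one, P.d_one _⟩
  comp hp hd a := P.compH hp hd a
  one_comp hp hd a g := by
    induction g using H.ind with | h g =>
    rw [compH_mk]
    exact congrArg _ (Subtype.ext (P.one_comp _ _ _ _))
  comp_one hp hd a f := by
    induction f using H.ind with | h f =>
    rw [compH_mk]
    exact congrArg _ (Subtype.ext (P.comp_one _ _ _ _))
  comp_assoc hp hs hq hs' hij ht hjl ht' a b c hc f g h := by
    induction f using H.ind with | h f =>
    induction g using H.ind with | h g =>
    induction h using H.ind with | h h =>
    rw [compH_mk, compH_mk, compH_mk, compH_mk]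
    exact congrArg _ (Subtype.ext (P.comp_assoc hp hs hq hs' hij ht hjl ht' a b c hc _ _ _))
  comp_comm hp hs hq hs' hij ht hil ht' a b hab b' hb' a' ha' f g h := by
    induction f using H.ind with | h f =>
    induction g using H.ind with | h g =>
    induction h using H.ind with | h h =>
    rw [compH_mk, compH_mk, compH_mk, compH_mk, Units.smul_def, ← map_zsmul]
    refine congrArg _ (Subtype.ext ?_)
    exact P.comp_comm hp hs hq hs' hij ht hil ht' a b hab b' hb' a' ha' _ _ _
  comp_act hp hd a σ τ f g := by
    induction f using H.ind with | h f =>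
    induction g using H.ind with | h g =>
    rw [actH_mk, actH_mk, compH_mk, compH_mk, actH_mk]
    exact congrArg _ (Subtype.ext (P.comp_act _ _ _ _ _ _ _))

end Homology

/-- The cohomology functor from dg operads to operads in graded vector spaces. -/
def homologyFunctor (k : Type u) [Field k] : DGOperad.{v} k ⥤ GradedOperad.{v} k where
  obj P := P.homology
  map {P Q} f := GradedOperad.Hom.mk
    (fun n i => Submodule.mapQ _ _
      (((Hom.toHom f).map n i).restrict fun x hx => by
        rw [mem_cycles rfl] at hx ⊢
        rw [← Hom.map_d f, hx, map_zero])
      (fun x hx => by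
        obtain ⟨y, hy⟩ := hx
        refine ⟨(Hom.toHom f).map n _ y, ?_⟩
        rw [← Hom.map_d f, hy]
        rfl))
    (fun σ x => by
      induction x using H.ind with | h x =>
      exact congrArg H.mk (Subtype.ext ((Hom.toHom f).map_act σ x.1)))
    (congrArg H.mk (Subtype.ext (Hom.toHom f).map_one))
    (fun hp hd a x y => by
      induction x using H.ind with | h x =>
      induction y using H.ind with | h y =>
      exact congrArg H.mk (Subtype.ext ((Hom.toHom f).map_comp hp hd a x.1 y.1)))
  map_id P := by
    apply GradedOperad.Hom.ext
    funext n i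
    refine LinearMap.ext fun x => ?_
    induction x using H.ind with | h x => rfl
  map_comp f g := by
    apply GradedOperad.Hom.ext
    funext n i
    refine LinearMap.ext fun x => ?_
    induction x using H.ind with | h x => rfl

/-- A morphism of dg operads is a quasi-isomorphism if it induces an isomorphism on cohomology
in every arity and every degree. -/
def QuasiIso {P Q : DGOperad.{v} k} (f : P ⟶ Q) : Prop :=
  ∀ (n : ℕ) (i : ℤ), Function.Bijective (GradedOperad.Hom.map ((homologyFunctor k).map f) n i)

end DGOperad

/-- An operad in graded vector spaces, viewed as a dg operad with zero differential. -/
def GradedOperad.toDGOperad (P : GradedOperad.{v} k) : DGOperad.{v} k where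
  toGradedOperad := P
  d _ := 0
  d_d _ _ _ := rfl
  d_act _ _ _ := by simp
  d_one _ := rfl
  d_comp _ _ _ _ _ _ _ _ _ _ := by simp

/-- A dg operad `P` is formal if it is connected to its cohomology `H(P)`, with zero differential,
by a (finite) chain of quasi-isomorphisms of dg operads, pointing in either direction. -/
def DGOperad.Formal (P : DGOperad.{v} k) : Prop :=
  Relation.EqvGen (fun Q R : DGOperad.{v} k => ∃ f : Q ⟶ R, DGOperad.QuasiIso f)
    P P.homology.toDGOperad

end Operadic

/-! On cohomology, σ - q^w acts on H^i as q^i - q^w, which is zero for i = w and invertible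
otherwise. Since σ need not be diagonalizable on `P` itself, its eigenspaces are replaced by
homotopy eigenspaces: the paths γ in P ⊗ k[s, ds] with σ γ(0) = q^w γ(1). Such a path records an
element together with a homotopy from it to q^{-w} σ of it, so the cohomology of these paths is H^w,
once in degree w (the kernel) and once more in degree w + 1 (the cokernel). Truncating to degrees at
most w, with only cocycles in degree w, removes the second copy.

Weights add under composition, because evaluation and σ are operad morphisms, and the truncations
are compatible with this. The direct sum over w is therefore a dg operad, `weightOperad`, and it
maps to both sides. Summing the starting points gives `weightToOperad`, with target P. Taking the
class of the starting point in the weight equal to the degree gives `weightToHomology`, with target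
H(P); the latter is multiplicative because weight is never smaller than degree.

Both are quasi-isomorphisms by three facts: a cocycle of degree i starts a closed path of weight i
(`exists_mem_weightSpace_of_mem_cycles`); a closed path of weight w in another degree starts at a
coboundary (`pathEval_zero_mem_boundaries`); in degrees at most w, a closed path that starts at a
coboundary bounds within weight w (`exists_weightSpace_d_eq`). Characteristic zero is what allows
integration in k[s]. -/

namespace Operadic

variable {k : Type u} [Field k]

/-! ### Convolution of finitely supported functions -/

section Convolution

variable {M : Type} [AddCommMonoid M] {X Y Z : Type v} [AddCommGroup X] [AddCommGroup Y]
  [AddCommGroup Z] [Module k X] [Module k Y] [Module k Z]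

/-- The extension of a bilinear map to "polynomials" with exponents in `M`. -/
noncomputable def convolution (M : Type) [AddCommMonoid M] (B : X →ₗ[k] Y →ₗ[k] Z) :
    (M →₀ X) →ₗ[k] (M →₀ Y) →ₗ[k] (M →₀ Z) :=
  Finsupp.lsum k fun m => LinearMap.flip (Finsupp.lsum k fun m' =>
    LinearMap.flip (B.compr₂ (Finsupp.lsingle (m + m'))))

@[simp]
theorem convolution_single_single (B : X →ₗ[k] Y →ₗ[k] Z) (m m' : M) (x : X) (y : Y) :
    convolution M B (Finsupp.single m x) (Finsupp.single m' y) =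
      Finsupp.single (m + m') (B x y) := by
  simp [convolution]

/-- The formal derivative of polynomials with coefficients in a module. -/
noncomputable def formalDeriv : (ℕ →₀ X) →ₗ[k] (ℕ →₀ X) :=
  Finsupp.lsum k fun m => (m : k) • Finsupp.lsingle (m - 1)

@[simp]
theorem formalDeriv_single (m : ℕ) (x : X) :
    formalDeriv (k := k) (Finsupp.single m x) = Finsupp.single (m - 1) ((m : k) • x) := by
  simp [formalDeriv]

theorem formalDeriv_mapRange (L : X →ₗ[k] Y) (x : ℕ →₀ X) :
    formalDeriv (k := k) (Finsupp.mapRange.linearMap L x) =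
      Finsupp.mapRange.linearMap L (formalDeriv (k := k) x) := by
  induction x using Finsupp.induction_linear with
  | zero => simp
  | add f f' e e' => simp only [map_add, e, e']
  | single m x => simp

theorem formalDeriv_convolution (B : X →ₗ[k] Y →ₗ[k] Z) (f : ℕ →₀ X) (g : ℕ →₀ Y) :
    formalDeriv (k := k) (convolution ℕ B f g) =
      convolution ℕ B (formalDeriv (k := k) f) g + convolution ℕ B f (formalDeriv (k := k) g) := by
  induction f using Finsupp.induction_linear with
  | zero => simp
  | add f f' e e' =>
    simp only [map_add, LinearMap.add_apply, e, e']
    abel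
  | single m x =>
  induction g using Finsupp.induction_linear with
  | zero => simp
  | add f f' e e' =>
    simp only [map_add, e, e']
    abel
  | single m' y =>
  -- The truncated exponent m - 1 is harmless at m = 0, where the scalar vanishes; only the case of
  -- two positive exponents needs arithmetic.
  rcases m with _ | m <;> rcases m' with _ | m'
  · simp
  · simp
  · simp
  · have h1 : m + 1 + (m' + 1) - 1 = m + m' + 1 := by omega
    have h2 : m + (m' + 1) = m + m' + 1 := by omega
    have h3 : m + 1 + m' = m + m' + 1 := by omega
    simp only [convolution_single_single, formalDeriv_single, Nat.add_sub_cancel, h1, h2, h3,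
      map_smul, LinearMap.smul_apply, ← Finsupp.single_add, ← add_smul]
    push_cast
    rfl

end Convolution

/-! ### Structure maps and signs -/

namespace GradedOperad

variable (P : GradedOperad.{v} k)

theorem comp_sign_left {m n p : ℕ} {i j l : ℤ} (hp : m + n = p + 1) (hd : i + j = l) (a : Fin m)
    (s : ℤˣ) (f : P.X m i) (g : P.X n j) :
    P.comp hp hd a (s • f) g = s • P.comp hp hd a f g := by
  rcases Int.units_eq_one_or s with rfl | rfl <;> simp [Units.smul_def]

theorem comp_sign_right {m n p : ℕ} {i j l : ℤ} (hp : m + n = p + 1) (hd : i + j = l) (a : Fin m)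
    (s : ℤˣ) (f : P.X m i) (g : P.X n j) :
    P.comp hp hd a f (s • g) = s • P.comp hp hd a f g := by
  rcases Int.units_eq_one_or s with rfl | rfl <;> simp [Units.smul_def]

theorem act_sign {n : ℕ} {i : ℤ} (σ : Equiv.Perm (Fin n)) (s : ℤˣ) (f : P.X n i) :
    P.act σ (s • f) = s • P.act σ f := by
  rcases Int.units_eq_one_or s with rfl | rfl <;> simp [Units.smul_def]

end GradedOperad

namespace DGOperad

theorem d_sign (P : DGOperad.{v} k) {n : ℕ} {i j : ℤ} (h : i + 1 = j) (s : ℤˣ) (f : P.X n i) :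
    P.d h (s • f) = s • P.d h f := by
  rcases Int.units_eq_one_or s with rfl | rfl <;> simp [Units.smul_def]

/-! ### Extension of scalars to a monoid algebra -/

/-- The dg operad `P ⊗ k[M]` of "polynomials" with coefficients in `P` and exponents in `M`. -/
noncomputable def polynomial (P : DGOperad.{v} k) (M : Type) [AddCommMonoid M] :
    DGOperad.{v} k where
  X n i := M →₀ P.X n i
  act σ := Finsupp.mapRange.linearMap (P.act σ)
  act_one x := by
    ext m
    simp [P.act_one]
  act_mul σ τ x := by
    ext m
    simp [P.act_mul]
  one := Finsupp.single 0 P.one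
  comp hp hd a := convolution M (P.comp hp hd a)
  one_comp hp hd a g := by
    induction g using Finsupp.induction_linear with
    | zero => simp
    | add g g' h h' => rw [map_add, h, h']
    | single m x => simp [P.one_comp]
  comp_one hp hd a f := by
    induction f using Finsupp.induction_linear with
    | zero => simp
    | add g g' h h' => rw [map_add, LinearMap.add_apply, h, h']
    | single m x => simp [P.comp_one]
  comp_assoc hp hs hq hs' hij ht hjl ht' a b c hc f g h := by
    induction f using Finsupp.induction_linear with
    | zero => simp
    | add f f' e e' => simp only [map_add, LinearMap.add_apply, e, e']
    | single m x =>
    induction g using Finsupp.induction_linear with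
    | zero => simp
    | add f f' e e' => simp only [map_add, LinearMap.add_apply, e, e']
    | single m' y =>
    induction h using Finsupp.induction_linear with
    | zero => simp
    | add f f' e e' => simp only [map_add, e, e']
    | single m'' z =>
    simp only [convolution_single_single, add_assoc,
      P.comp_assoc hp hs hq hs' hij ht hjl ht' a b c hc]
  comp_comm hp hs hq hs' hij ht hil ht' a b hab b' hb' a' ha' f g h := by
    induction f using Finsupp.induction_linear with
    | zero => simp
    | add f f' e e' => simp only [map_add, LinearMap.add_apply, e, e', smul_add]
    | single m x =>
    induction g using Finsupp.induction_linear with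
    | zero => simp
    | add f f' e e' => simp only [map_add, LinearMap.add_apply, e, e', smul_add]
    | single m' y =>
    induction h using Finsupp.induction_linear with
    | zero => simp
    | add f f' e e' => simp only [map_add, LinearMap.add_apply, e, e', smul_add]
    | single m'' z =>
    simp only [convolution_single_single, Finsupp.smul_single, add_right_comm m m' m'',
      P.comp_comm hp hs hq hs' hij ht hil ht' a b hab b' hb' a' ha']
  comp_act hp hd a σ τ f g := by
    induction f using Finsupp.induction_linear with
    | zero => simp
    | add f f' e e' => simp only [map_add, LinearMap.add_apply, e, e']
    | single m x =>
    induction g using Finsupp.induction_linear with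
    | zero => simp
    | add f f' e e' => simp only [map_add, e, e']
    | single m' y =>
    simp [P.comp_act]
  d h := Finsupp.mapRange.linearMap (P.d h)
  d_d h h' x := by
    ext m
    simp [P.d_d]
  d_act h σ x := by
    ext m
    simp [P.d_act]
  d_one h := by simp [P.d_one]
  d_comp hp hd hi hj hl h₁ h₂ a f g := by
    induction f using Finsupp.induction_linear with
    | zero => simp
    | add f f' e e' =>
      simp only [map_add, LinearMap.add_apply, e, e', smul_add]
      abel
    | single m x =>
    induction g using Finsupp.induction_linear with
    | zero => simp
    | add f f' e e' =>
      simp only [map_add, e, e', smul_add]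
      abel
    | single m' y =>
    simp [P.d_comp hp hd hi hj hl h₁ h₂]

/-! ### Adjoining a differential to a derivation -/

/-- A degree zero derivation of a dg operad commuting with the differential. -/
structure Derivation (P : DGOperad.{v} k) where
  map : ∀ {n : ℕ} {i : ℤ}, P.X n i →ₗ[k] P.X n i
  map_act : ∀ {n : ℕ} {i : ℤ} (σ : Equiv.Perm (Fin n)) (x : P.X n i),
    map (P.act σ x) = P.act σ (map x)
  map_one : map P.one = 0
  map_comp : ∀ {m n p : ℕ} {i j l : ℤ} (hp : m + n = p + 1) (hd : i + j = l) (a : Fin m)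
    (f : P.X m i) (g : P.X n j),
    map (P.comp hp hd a f g) = P.comp hp hd a (map f) g + P.comp hp hd a f (map g)
  map_d : ∀ {n : ℕ} {i j : ℤ} (h : i + 1 = j) (x : P.X n i), map (P.d h x) = P.d h (map x)

/-- The derivation `d/ds` of `P[s]`. -/
noncomputable def polynomialDerivation (P : DGOperad.{v} k) : Derivation (P.polynomial ℕ) where
  map := formalDeriv (k := k)
  map_act _ x := formalDeriv_mapRange _ x
  map_one := by
    refine (formalDeriv_single _ _).trans ?_
    simp only [Nat.cast_zero, zero_smul, Finsupp.single_zero]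
    rfl
  map_comp _ _ _ f g := formalDeriv_convolution _ f g
  map_d _ x := formalDeriv_mapRange _ x

namespace Derivation

variable {P : DGOperad.{v} k} (D : P.Derivation)

/-- A derivation with specified degrees. -/
def castMap {n : ℕ} {i j : ℤ} (h : i = j) : P.X n i →ₗ[k] P.X n j :=
  h ▸ D.map

theorem castMap_act {n : ℕ} {i j : ℤ} (h : i = j) (σ : Equiv.Perm (Fin n)) (x : P.X n i) :
    D.castMap h (P.act σ x) = P.act σ (D.castMap h x) := by
  subst h
  exact D.map_act σ x

theorem castMap_one {j : ℤ} (h : 0 = j) : D.castMap h P.one = 0 := by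
  subst h
  exact D.map_one

theorem castMap_comp {m n p : ℕ} {i j l i' j' l' : ℤ} (hp : m + n = p + 1) (hd : i + j = l)
    (hi : i = i') (hj : j = j') (hl : l = l') (h₁ : i' + j = l') (h₂ : i + j' = l')
    (a : Fin m) (f : P.X m i) (g : P.X n j) :
    D.castMap hl (P.comp hp hd a f g) =
      P.comp hp h₁ a (D.castMap hi f) g + P.comp hp h₂ a f (D.castMap hj g) := by
  subst hi hj hl
  exact D.map_comp hp hd a f g

theorem castMap_d {n : ℕ} {i j j' l : ℤ} (h : i + 1 = j) (h' : j = j') (hl : i = l)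
    (h'' : l + 1 = j') (x : P.X n i) :
    D.castMap h' (P.d h x) = P.d h'' (D.castMap hl x) := by
  subst h' hl
  exact D.map_d h x

end Derivation

/-- Given a derivation `D` of `P`, the dg operad of elements `x + ε y` with `ε` of degree one,
`ε² = 0` and `d x` increased by `ε D x`. -/
noncomputable def Derivation.extension {P : DGOperad.{v} k} (D : P.Derivation) :
    DGOperad.{v} k where
  X n i := P.X n i × P.X n (i - 1)
  act σ := (P.act σ).prodMap (P.act σ)
  act_one x := by simp [P.act_one]
  act_mul σ τ x := by simp [P.act_mul]
  one := (P.one, 0)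
  comp {m n p i j l} hp hd a := LinearMap.mk₂ k
    -- ε stands to the left of its coefficient: moving it past `f.1`, of degree i, costs (-1)^i, and
    -- the product of the two ε-parts disappears since ε² = 0.
    (fun f g => (P.comp hp hd a f.1 g.1,
      P.comp (i := i - 1) (l := l - 1) hp (by omega) a f.2 g.1 +
        i.negOnePow • P.comp (j := j - 1) (l := l - 1) hp (by omega) a f.1 g.2))
    (fun _ _ _ => Prod.ext (by simp) (by simp; abel))
    (fun _ _ _ => Prod.ext (by simp) (by
      simp only [Prod.smul_fst, Prod.smul_snd, map_smul, LinearMap.smul_apply,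
        smul_add, Units.smul_def, smul_comm (_ : k) (_ : ℤ)]))
    (fun _ _ _ => Prod.ext (by simp) (by simp; abel))
    (fun _ _ _ => Prod.ext (by simp) (by
      simp only [Prod.smul_fst, Prod.smul_snd, map_smul,
        smul_add, Units.smul_def, smul_comm (_ : k) (_ : ℤ)]))
  one_comp hp hd a g := by simp [P.one_comp]
  comp_one hp hd a f := by simp [P.comp_one]
  comp_assoc hp hs hq hs' hij ht hjl ht' a b c hc f g h := by
    refine Prod.ext ?_ ?_
    · exact P.comp_assoc hp hs hq hs' hij ht hjl ht' a b c hc _ _ _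
    · simp only [LinearMap.mk₂_apply, map_add, LinearMap.add_apply, P.comp_sign_left,
        P.comp_sign_right, smul_add, smul_smul]
      rw [P.comp_assoc hp hs hq hs' _ _ _ _ a b c hc, P.comp_assoc hp hs hq hs' _ _ _ _ a b c hc,
        P.comp_assoc hp hs hq hs' _ _ _ _ a b c hc, ← hij, Int.negOnePow_add, add_assoc]
  comp_comm {m n r p q s i j l ij il t} hp hs hq hs' hij ht hil ht' a b hab b' hb' a' ha'
      f g h := by
    refine Prod.ext ?_ ?_
    · exact P.comp_comm hp hs hq hs' hij ht hil ht' a b hab b' hb' a' ha' _ _ _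
    · simp only [LinearMap.mk₂_apply, map_add, LinearMap.add_apply, P.comp_sign_left,
        smul_add, smul_smul, Prod.smul_snd]
      rw [P.comp_comm hp hs hq hs' _ _ (il := il - 1) _ _ a b hab b' hb' a' ha' f.2,
        P.comp_comm hp hs hq hs' _ _ (il := il) _ _ a b hab b' hb' a' ha' f.1 g.2,
        P.comp_comm hp hs hq hs' _ _ (il := il - 1) _ _ a b hab b' hb' a' ha' f.1 g.1 h.2]
      · have hij' : ij.negOnePow = i.negOnePow * j.negOnePow := by
          rw [← hij, Int.negOnePow_add]
        have hil' : il.negOnePow = i.negOnePow * l.negOnePow := by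
          rw [← hil, Int.negOnePow_add]
        simp only [hij', hil', mul_sub, sub_mul, Int.negOnePow_sub, mul_one, one_mul,
          smul_smul]
        -- All signs are now products of those of i, j, l and j * l, so the identity is checked for
        -- each choice of these four.
        rcases Int.units_eq_one_or i.negOnePow with h1 | h1 <;>
        rcases Int.units_eq_one_or j.negOnePow with h2 | h2 <;>
        rcases Int.units_eq_one_or l.negOnePow with h3 | h3 <;>
        rcases Int.units_eq_one_or (j * l).negOnePow with h4 | h4 <;>
        simp only [h1, h2, h3, h4, mul_one, mul_neg, neg_neg, one_smul, Units.neg_smul] <;>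
        abel_nf
      all_goals omega
  comp_act hp hd a σ τ f g := by
    refine Prod.ext ?_ ?_
    · exact P.comp_act _ _ _ _ _ _ _
    · simp [P.comp_act, P.act_sign]
  d {n i j} h := LinearMap.prod (P.d h ∘ₗ LinearMap.fst k _ _)
    -- The minus sign comes from d passing the odd element ε. The degrees i and j - 1 agree only
    -- propositionally, hence `castMap`.
    (D.castMap (j := j - 1) (by omega) ∘ₗ LinearMap.fst k _ _ -
      P.d (by omega) ∘ₗ LinearMap.snd k _ _)
  d_d {n i j l} h h' x := by
    refine Prod.ext (P.d_d _ _ _) ?_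
    simp [P.d_d, D.castMap_d h (by omega : j = l - 1) (by omega : i = j - 1) (by omega)]
  d_act h σ x := by
    refine Prod.ext (P.d_act _ _ _) ?_
    simp [P.d_act, D.castMap_act]
  d_one h := by
    refine Prod.ext (P.d_one _) ?_
    simp [D.castMap_one]
  d_comp {m n p i i' j j' l l'} hp hd hi hj hl h₁ h₂ a f g := by
    refine Prod.ext (P.d_comp hp hd hi hj hl h₁ h₂ a _ _) ?_
    -- The ε-part of the Leibniz rule combines three identities: the Leibniz rules in P for the two
    -- mixed terms, and the derivation rule of D for the product of the ε-free parts.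
    have e1 := P.d_comp hp (i := i - 1) (i' := i' - 1) (l := l - 1) (l' := l' - 1) (by omega)
      (by omega) hj (by omega) (by omega) (by omega) a f.2 g.1
    have e2 := P.d_comp hp (j := j - 1) (j' := j' - 1) (l := l - 1) (l' := l' - 1) (by omega)
      hi (by omega) (by omega) (by omega) (by omega) a f.1 g.2
    have e3 := D.castMap_comp hp hd (by omega : i = i' - 1) (by omega : j = j' - 1)
      (by omega : l = l' - 1) (by omega) (by omega) a f.1 g.1
    have hs : i'.negOnePow = - i.negOnePow := by
      rw [← hi, Int.negOnePow_succ]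
    have hs' : (i - 1).negOnePow = - i.negOnePow := by
      rw [Int.negOnePow_sub]
      simp
    change D.castMap (by omega : l = l' - 1) (P.comp hp hd a f.1 g.1) -
        P.d (by omega : l - 1 + 1 = l' - 1)
          (P.comp (i := i - 1) (l := l - 1) hp (by omega) a f.2 g.1 +
          i.negOnePow • P.comp (j := j - 1) (l := l - 1) hp (by omega) a f.1 g.2) =
      (P.comp (i := i' - 1) (l := l' - 1) hp (by omega) a
          (D.castMap (by omega : i = i' - 1) f.1 - P.d (by omega : i - 1 + 1 = i' - 1) f.2) g.1 +
        i'.negOnePow • P.comp (j := j - 1) (l := l' - 1) hp (by omega) a (P.d hi f.1) g.2) +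
      i.negOnePow • (P.comp (i := i - 1) (l := l' - 1) hp (by omega) a f.2 (P.d hj g.1) +
        i.negOnePow • P.comp (j := j' - 1) (l := l' - 1) hp (by omega) a f.1
          (D.castMap (by omega : j = j' - 1) g.1 - P.d (by omega : j - 1 + 1 = j' - 1) g.2))
    rw [map_add, P.d_sign, e1, e2, e3, hs, hs']
    rcases Int.units_eq_one_or i.negOnePow with h | h <;>
    · simp only [h, map_sub, LinearMap.sub_apply, one_smul, Units.neg_smul,
        smul_add, smul_neg, neg_neg]
      abel

end DGOperad

/-! ### Coefficients, evaluation and integration of polynomials -/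

section Convolution

variable {M : Type} [AddCommMonoid M] {X Y Z : Type v} [AddCommGroup X] [AddCommGroup Y]
  [AddCommGroup Z] [Module k X] [Module k Y] [Module k Z]

theorem convolution_eq_sum (B : X →ₗ[k] Y →ₗ[k] Z) (f : M →₀ X) (g : M →₀ Y) :
    convolution M B f g =
      f.sum fun m x => g.sum fun m' y => Finsupp.single (m + m') (B x y) := by
  simp [convolution, Finsupp.sum]

/-- Coefficients of a product lie in a family of submodules as soon as the products of the
coefficients do. -/
theorem convolution_apply_mem (B : X →ₗ[k] Y →ₗ[k] Z) (S : M → Submodule k Z) (f : M →₀ X)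
    (g : M →₀ Y) (h : ∀ m m', B (f m) (g m') ∈ S (m + m')) (m : M) :
    convolution M B f g m ∈ S m := by
  classical
  rw [convolution_eq_sum]
  simp only [Finsupp.sum, Finsupp.finsetSum_apply]
  refine Submodule.sum_mem _ fun a _ => Submodule.sum_mem _ fun b _ => ?_
  rw [Finsupp.single_apply]
  split_ifs with e
  · exact e ▸ h a b
  · exact Submodule.zero_mem _

/-- A coefficient of a product to which only one pair of coefficients contributes. -/
theorem convolution_apply_eq (B : X →ₗ[k] Y →ₗ[k] Z) (f : M →₀ X) (g : M →₀ Y) (a b : M)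
    (h : ∀ m m', m + m' = a + b → B (f m) (g m') ≠ 0 → m = a ∧ m' = b) :
    convolution M B f g (a + b) = B (f a) (g b) := by
  classical
  rw [convolution_eq_sum]
  simp only [Finsupp.sum, Finsupp.finsetSum_apply]
  rw [Finset.sum_eq_single a, Finset.sum_eq_single b]
  · simp
  · intro m' _ hm'
    rw [Finsupp.single_apply]
    split_ifs with e
    · by_contra h'
      exact hm' (h _ _ e h').2
    · rfl
  · intro hb
    simp [Finsupp.notMem_support_iff.1 hb]
  · intro m _ hm
    refine Finset.sum_eq_zero fun m' _ => ?_
    rw [Finsupp.single_apply]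
    split_ifs with e
    · by_contra h'
      exact hm (h _ _ e h').1
    · rfl
  · intro ha
    simp [Finsupp.notMem_support_iff.1 ha]

/-- Evaluation of "polynomials" at a character of the exponents. -/
noncomputable def characterEval (χ : Multiplicative M →* k) : (M →₀ X) →ₗ[k] X :=
  Finsupp.lsum k fun m => χ (Multiplicative.ofAdd m) • LinearMap.id

@[simp]
theorem characterEval_single (χ : Multiplicative M →* k) (m : M) (x : X) :
    characterEval χ (Finsupp.single m x) = χ (Multiplicative.ofAdd m) • x := by
  simp [characterEval]

theorem characterEval_mapRange (χ : Multiplicative M →* k) (L : X →ₗ[k] Y) (x : M →₀ X) :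
    characterEval χ (Finsupp.mapRange.linearMap L x) = L (characterEval χ x) := by
  induction x using Finsupp.induction_linear with
  | zero => simp
  | add f f' e e' => simp only [map_add, e, e']
  | single m x => simp

theorem characterEval_convolution (χ : Multiplicative M →* k) (B : X →ₗ[k] Y →ₗ[k] Z)
    (f : M →₀ X) (g : M →₀ Y) :
    characterEval χ (convolution M B f g) = B (characterEval χ f) (characterEval χ g) := by
  induction f using Finsupp.induction_linear with
  | zero => simp
  | add f f' e e' => simp only [map_add, LinearMap.add_apply, e, e']
  | single m x =>
  induction g using Finsupp.induction_linear with
  | zero => simp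
  | add f f' e e' => simp only [map_add, e, e']
  | single m' y => simp [smul_smul, mul_comm]

/-- Evaluation of polynomials at a scalar. -/
noncomputable abbrev evalAt (c : k) : (ℕ →₀ X) →ₗ[k] X :=
  characterEval (powersHom k c)

theorem evalAt_single (c : k) (m : ℕ) (x : X) :
    evalAt c (Finsupp.single m x) = c ^ m • x := by
  simp

/-- The formal integral, with zero constant term, of polynomials with coefficients in a
module. -/
noncomputable def formalIntegral : (ℕ →₀ X) →ₗ[k] (ℕ →₀ X) :=
  Finsupp.lsum k fun m => ((m : k) + 1)⁻¹ • Finsupp.lsingle (m + 1)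

@[simp]
theorem formalIntegral_single (m : ℕ) (x : X) :
    formalIntegral (k := k) (Finsupp.single m x) =
      Finsupp.single (m + 1) (((m : k) + 1)⁻¹ • x) := by
  simp [formalIntegral]

theorem formalIntegral_mapRange (L : X →ₗ[k] Y) (x : ℕ →₀ X) :
    formalIntegral (k := k) (Finsupp.mapRange.linearMap L x) =
      Finsupp.mapRange.linearMap L (formalIntegral (k := k) x) := by
  induction x using Finsupp.induction_linear with
  | zero => simp
  | add f f' e e' => simp only [map_add, e, e']
  | single m x => simp

theorem evalAt_zero_formalIntegral (x : ℕ →₀ X) :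
    evalAt (0 : k) (formalIntegral (k := k) x) = 0 := by
  induction x using Finsupp.induction_linear with
  | zero => simp
  | add f f' e e' => rw [map_add, map_add, e, e', add_zero]
  | single m x => simp

theorem formalDeriv_formalIntegral [CharZero k] (x : ℕ →₀ X) :
    formalDeriv (k := k) (formalIntegral (k := k) x) = x := by
  induction x using Finsupp.induction_linear with
  | zero => simp
  | add f f' e e' => rw [map_add, map_add, e, e']
  | single m x =>
    have : (m : k) + 1 ≠ 0 := by exact_mod_cast m.succ_ne_zero
    simp [smul_smul, this]

/-- The fundamental theorem of calculus. -/
theorem formalIntegral_formalDeriv [CharZero k] (x : ℕ →₀ X) :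
    formalIntegral (k := k) (formalDeriv (k := k) x) =
      x - Finsupp.single 0 (evalAt (0 : k) x) := by
  induction x using Finsupp.induction_linear with
  | zero => simp
  | add f f' e e' =>
    rw [map_add, map_add, e, e', map_add, Finsupp.single_add]
    abel
  | single m x =>
    rcases m with _ | m
    · simp
    · have : (m : k) + 1 ≠ 0 := by exact_mod_cast m.succ_ne_zero
      simp [smul_smul, this]

end Convolution

namespace DGOperad

/-! ### Quasi-isomorphisms in terms of cocycles -/

theorem H.mk_eq_mk {P : DGOperad.{v} k} {n : ℕ} {i : ℤ} {x y : P.cycles n i} :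
    (H.mk x : P.H n i) = H.mk y ↔ x.1 - y.1 ∈ P.boundaries n i :=
  Submodule.Quotient.eq _

theorem H.mk_eq_zero {P : DGOperad.{v} k} {n : ℕ} {i : ℤ} {x : P.cycles n i} :
    (H.mk x : P.H n i) = 0 ↔ x.1 ∈ P.boundaries n i :=
  Submodule.Quotient.mk_eq_zero _

theorem Hom.map_mem_cycles {P Q : DGOperad.{v} k} (f : P ⟶ Q) {n : ℕ} {i : ℤ} {x : P.X n i}
    (hx : x ∈ P.cycles n i) : (Hom.toHom f).map n i x ∈ Q.cycles n i := by
  rw [mem_cycles rfl] at hx ⊢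
  rw [← Hom.map_d f, hx, map_zero]

theorem homologyFunctor_map_mk {P Q : DGOperad.{v} k} (f : P ⟶ Q) {n : ℕ} {i : ℤ}
    (x : P.cycles n i) :
    GradedOperad.Hom.map ((homologyFunctor k).map f) n i (H.mk x) =
      (H.mk ⟨(Hom.toHom f).map n i x.1, f.map_mem_cycles x.2⟩ : Q.H n i) :=
  rfl

/-- Surjectivity is asked on cocycles themselves, not just up to coboundaries; this stronger
condition holds for both maps of the zigzag. -/
theorem quasiIso_of_cycles {P Q : DGOperad.{v} k} (f : P ⟶ Q)
    (inj : ∀ (n : ℕ) (i : ℤ) (x : P.X n i), x ∈ P.cycles n i →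
      (Hom.toHom f).map n i x ∈ Q.boundaries n i → x ∈ P.boundaries n i)
    (surj : ∀ (n : ℕ) (i : ℤ) (y : Q.X n i), y ∈ Q.cycles n i →
      ∃ x ∈ P.cycles n i, (Hom.toHom f).map n i x = y) :
    QuasiIso f := by
  intro n i
  constructor
  · refine (injective_iff_map_eq_zero _).2 fun x => ?_
    induction x using H.ind with | h x =>
    intro hx
    rw [homologyFunctor_map_mk] at hx
    exact H.mk_eq_zero.2 (inj n i x.1 x.2 (H.mk_eq_zero.1 hx))
  · intro y
    induction y using H.ind with | h y =>
    obtain ⟨x, hx, e⟩ := surj n i y.1 y.2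
    exact ⟨H.mk ⟨x, hx⟩, (homologyFunctor_map_mk f _).trans (congrArg H.mk (Subtype.ext e))⟩

/-! ### Suboperads -/

/-- The dg operad given by subspaces closed under all the structure. -/
def suboperad (P : DGOperad.{v} k) (S : ∀ n i, Submodule k (P.X n i))
    (hact : ∀ {n : ℕ} {i : ℤ} (σ : Equiv.Perm (Fin n)) {x : P.X n i}, x ∈ S n i →
      P.act σ x ∈ S n i)
    (hone : P.one ∈ S 1 0)
    (hcomp : ∀ {m n p : ℕ} {i j l : ℤ} (hp : m + n = p + 1) (hd : i + j = l) (a : Fin m)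
      {f : P.X m i} {g : P.X n j}, f ∈ S m i → g ∈ S n j → P.comp hp hd a f g ∈ S p l)
    (hdiff : ∀ {n : ℕ} {i j : ℤ} (h : i + 1 = j) {x : P.X n i}, x ∈ S n i →
      P.d h x ∈ S n j) :
    DGOperad.{v} k where
  X n i := S n i
  act σ := (P.act σ).restrict fun _ hx => hact σ hx
  act_one x := Subtype.ext (P.act_one _)
  act_mul σ τ x := Subtype.ext (P.act_mul _ _ _)
  one := ⟨P.one, hone⟩
  comp hp hd a := LinearMap.mk₂ k (fun f g => ⟨P.comp hp hd a f.1 g.1, hcomp hp hd a f.2 g.2⟩)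
    (fun _ _ _ => Subtype.ext (by simp)) (fun _ _ _ => Subtype.ext (by simp))
    (fun _ _ _ => Subtype.ext (by simp)) (fun _ _ _ => Subtype.ext (by simp))
  one_comp hp hd a g := Subtype.ext (P.one_comp _ _ _ _)
  comp_one hp hd a f := Subtype.ext (P.comp_one _ _ _ _)
  comp_assoc hp hs hq hs' hij ht hjl ht' a b c hc f g h :=
    Subtype.ext (P.comp_assoc hp hs hq hs' hij ht hjl ht' a b c hc _ _ _)
  comp_comm hp hs hq hs' hij ht hil ht' a b hab b' hb' a' ha' f g h :=
    Subtype.ext (P.comp_comm hp hs hq hs' hij ht hil ht' a b hab b' hb' a' ha' _ _ _)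
  comp_act hp hd a σ τ f g := Subtype.ext (P.comp_act _ _ _ _ _ _ _)
  d h := (P.d h).restrict fun _ hx => hdiff h hx
  d_d h h' x := Subtype.ext (P.d_d _ _ _)
  d_act h σ x := Subtype.ext (P.d_act _ _ _)
  d_one h := Subtype.ext (P.d_one _)
  d_comp hp hd hi hj hl h₁ h₂ a f g := Subtype.ext (P.d_comp hp hd hi hj hl h₁ h₂ a _ _)

/-! ### The path operad -/

/-- Evaluation of "polynomials" at a character, as a morphism of dg operads. -/
noncomputable def polynomialEval (P : DGOperad.{v} k) {M : Type} [AddCommMonoid M]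
    (χ : Multiplicative M →* k) : P.polynomial M ⟶ P :=
  Hom.mk
    { map := fun _ _ => characterEval χ
      map_act := fun σ x => characterEval_mapRange χ (P.act σ) x
      map_one := by
        refine (characterEval_single χ _ _).trans ?_
        simp
      map_comp := fun _ _ _ f g => characterEval_convolution χ _ f g }
    (fun h x => characterEval_mapRange χ (P.d h) x)

/-- The projection killing `ε`. -/
def Derivation.projection {P : DGOperad.{v} k} (D : P.Derivation) : D.extension ⟶ P :=
  Hom.mk
    { map := fun _ _ => LinearMap.fst k _ _
      map_act := fun _ _ => rfl
      map_one := rfl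
      map_comp := fun _ _ _ _ _ => rfl }
    (fun _ _ => rfl)

/-- The dg operad `P ⊗ k[s, ds]`. -/
noncomputable def path (P : DGOperad.{v} k) : DGOperad.{v} k :=
  P.polynomialDerivation.extension

/-- The value of a path at `s = c`. -/
noncomputable def pathEval (P : DGOperad.{v} k) (c : k) : P.path ⟶ P :=
  P.polynomialDerivation.projection ≫ P.polynomialEval (powersHom k c)

/-- The path `a + ds b`. -/
def pathMk (P : DGOperad.{v} k) {n : ℕ} {i : ℤ} (a : ℕ →₀ P.X n i) (b : ℕ →₀ P.X n (i - 1)) :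
    P.path.X n i := (a, b)

theorem pathMk_surjective {P : DGOperad.{v} k} {n : ℕ} {i : ℤ} (γ : P.path.X n i) :
    ∃ a b, P.pathMk a b = γ := ⟨γ.1, γ.2, rfl⟩

theorem pathEval_pathMk {P : DGOperad.{v} k} (c : k) {n : ℕ} {i : ℤ} (a : ℕ →₀ P.X n i)
    (b : ℕ →₀ P.X n (i - 1)) :
    (Hom.toHom (P.pathEval c)).map n i (P.pathMk a b) = evalAt c a := rfl

theorem d_pathMk {P : DGOperad.{v} k} {n : ℕ} {i : ℤ} (a : ℕ →₀ P.X n (i - 1))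
    (b : ℕ →₀ P.X n (i - 1 - 1)) :
    P.path.d (sub_add_cancel i 1) (P.pathMk a b) =
      P.pathMk (Finsupp.mapRange.linearMap (P.d (sub_add_cancel i 1)) a)
        (formalDeriv (k := k) a -
          Finsupp.mapRange.linearMap (P.d (sub_add_cancel (i - 1) 1)) b) := rfl

theorem pathMk_mem_cycles {P : DGOperad.{v} k} {n : ℕ} {i : ℤ} {a : ℕ →₀ P.X n i}
    {b : ℕ →₀ P.X n (i - 1)} :
    P.pathMk a b ∈ P.path.cycles n i ↔
      Finsupp.mapRange.linearMap (P.d (rfl : i + 1 = i + 1)) a = 0 ∧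
      formalDeriv (k := k) a = Finsupp.mapRange.linearMap (P.d (sub_add_cancel i 1)) b := by
  -- The degree is generalized to a variable j so that substitution removes the cast hidden in
  -- `castMap`.
  have key : ∀ (j : ℤ) (h : i = j) (h' : i - 1 + 1 = j),
      P.polynomialDerivation.castMap h a - (P.polynomial ℕ).d h' b = 0 ↔
      formalDeriv (k := k) a = Finsupp.mapRange.linearMap (P.d (sub_add_cancel i 1)) b := by
    intro j h h'
    subst h
    exact sub_eq_zero
  rw [mem_cycles rfl]
  exact Prod.ext_iff.trans (and_congr Iff.rfl (key _ _ _))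

variable {P : DGOperad.{v} k}

/-! ### Closed paths -/

/-- Closedness of a + ds b contains the equation a' = d b; integrating it from 0 shows that ∫ b is a
primitive of a up to the constant a(0). -/
theorem formalIntegral_mapRange_d [CharZero k] {n : ℕ} {i : ℤ} {a : ℕ →₀ P.X n i}
    {b : ℕ →₀ P.X n (i - 1)} (h : P.pathMk a b ∈ P.path.cycles n i) :
    Finsupp.mapRange.linearMap (P.d (sub_add_cancel i 1)) (formalIntegral (k := k) b) =
      a - Finsupp.single 0 (evalAt (0 : k) a) := by
  rw [← formalIntegral_mapRange, ← (pathMk_mem_cycles.1 h).2, formalIntegral_formalDeriv]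

/-- The end points of a closed path are cohomologous. -/
theorem evalAt_one_eq [CharZero k] {n : ℕ} {i : ℤ} {a : ℕ →₀ P.X n i}
    {b : ℕ →₀ P.X n (i - 1)} (h : P.pathMk a b ∈ P.path.cycles n i) :
    evalAt (1 : k) a = evalAt (0 : k) a +
      P.d (sub_add_cancel i 1) (evalAt (1 : k) (formalIntegral (k := k) b)) := by
  have := congrArg (evalAt (1 : k)) (formalIntegral_mapRange_d h)
  rw [characterEval_mapRange, map_sub, evalAt_single, one_pow, one_smul] at this
  rw [this]
  abel

/-- The coefficients of an operation of `P ⊗ k[M]`. -/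
noncomputable def coeff {M : Type} [AddCommMonoid M] (m : M) {n : ℕ} {i : ℤ} :
    (P.polynomial M).X n i →ₗ[k] P.X n i :=
  Finsupp.lapply m

theorem coeff_zero_one {M : Type} [AddCommMonoid M] :
    coeff (0 : M) (P.polynomial M).one = P.one :=
  Finsupp.single_eq_same

theorem coeff_one_of_ne {M : Type} [AddCommMonoid M] {m : M} (h : m ≠ 0) :
    coeff m (P.polynomial M).one = 0 :=
  Finsupp.single_eq_of_ne h

/-! ### Paths of a given weight -/

/-- The paths `γ` with `σ γ(0) = q ^ w γ(1)`, truncated to degrees at most `w`. -/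
noncomputable def weightSpace (σ : P ⟶ P) (q : kˣ) (w : ℤ) (n : ℕ) (i : ℤ) :
    Submodule k (P.path.X n i) where
  carrier := {γ | (Hom.toHom σ).map n i ((Hom.toHom (P.pathEval 0)).map n i γ) =
    ((q ^ w : kˣ) : k) • (Hom.toHom (P.pathEval 1)).map n i γ ∧ (w < i → γ = 0) ∧
    (w = i → γ ∈ P.path.cycles n i)}
  add_mem' := by
    rintro γ δ ⟨h1, h2, h3⟩ ⟨h1', h2', h3'⟩
    refine ⟨?_, fun h => ?_, fun h => ?_⟩
    · rw [map_add, map_add, map_add, h1, h1', smul_add]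
    · rw [h2 h, h2' h, add_zero]
    · exact add_mem (h3 h) (h3' h)
  zero_mem' := ⟨by simp, fun _ => rfl, fun _ => zero_mem _⟩
  smul_mem' := by
    rintro c γ ⟨h1, h2, h3⟩
    refine ⟨?_, fun h => ?_, fun h => ?_⟩
    · rw [map_smul, map_smul, map_smul, h1, smul_comm]
    · rw [h2 h, smul_zero]
    · exact Submodule.smul_mem _ _ (h3 h)

section WeightSpace

variable (σ : P ⟶ P) (q : kˣ)

theorem mem_weightSpace {w : ℤ} {n : ℕ} {i : ℤ} {γ : P.path.X n i} :
    γ ∈ weightSpace σ q w n i ↔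
      (Hom.toHom σ).map n i ((Hom.toHom (P.pathEval 0)).map n i γ) =
        ((q ^ w : kˣ) : k) • (Hom.toHom (P.pathEval 1)).map n i γ ∧ (w < i → γ = 0) ∧
      (w = i → γ ∈ P.path.cycles n i) := Iff.rfl

theorem act_mem_weightSpace {w : ℤ} {n : ℕ} {i : ℤ} (τ : Equiv.Perm (Fin n)) {γ : P.path.X n i}
    (h : γ ∈ weightSpace σ q w n i) : P.path.act τ γ ∈ weightSpace σ q w n i := by
  obtain ⟨h1, h2, h3⟩ := h
  refine ⟨?_, fun h => ?_, fun h => act_mem_cycles τ (h3 h)⟩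
  · rw [GradedOperad.Hom.map_act, GradedOperad.Hom.map_act, h1, GradedOperad.Hom.map_act, map_smul]
  · rw [h2 h, map_zero]

theorem one_mem_weightSpace : P.path.one ∈ weightSpace σ q 0 1 0 := by
  refine ⟨?_, fun h => absurd h (lt_irrefl _), fun h => (mem_cycles rfl).2 (P.path.d_one _)⟩
  simp [GradedOperad.Hom.map_one]

/-- The scalars q^w and q^w' multiply at the end points. For nonzero factors the degrees are at most
the weights, so total degree equal to total weight forces equality in both factors, and both are
then cocycles. -/
theorem comp_mem_weightSpace {w w' : ℤ} {m n p : ℕ} {i j l : ℤ} (hp : m + n = p + 1)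
    (hd : i + j = l) (a : Fin m) {γ : P.path.X m i} {δ : P.path.X n j}
    (h : γ ∈ weightSpace σ q w m i) (h' : δ ∈ weightSpace σ q w' n j) :
    P.path.comp hp hd a γ δ ∈ weightSpace σ q (w + w') p l := by
  obtain ⟨h1, h2, h3⟩ := h
  obtain ⟨h1', h2', h3'⟩ := h'
  refine ⟨?_, fun h => ?_, fun h => ?_⟩
  · rw [GradedOperad.Hom.map_comp, GradedOperad.Hom.map_comp, h1, h1', GradedOperad.Hom.map_comp]
    simp [smul_smul, zpow_add, mul_comm]
  · rcases lt_or_ge w i with hw | hw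
    · rw [h2 hw, map_zero, LinearMap.zero_apply]
    · rw [h2' (by omega), map_zero]
  · rcases lt_trichotomy w i with hw | hw | hw
    · rw [h2 hw, map_zero, LinearMap.zero_apply]
      exact zero_mem _
    · exact comp_mem_cycles hp hd a (h3 hw) (h3' (by omega))
    · rw [h2' (by omega), map_zero]
      exact zero_mem _

/-- This is why degree w keeps only cocycles: the differential must not lead into the truncated
degree w + 1. -/
theorem d_mem_weightSpace {w : ℤ} {n : ℕ} {i j : ℤ} (hij : i + 1 = j) {γ : P.path.X n i}
    (h : γ ∈ weightSpace σ q w n i) : P.path.d hij γ ∈ weightSpace σ q w n j := by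
  obtain ⟨h1, h2, h3⟩ := h
  refine ⟨?_, fun h => ?_, fun h => (mem_cycles rfl).2 (P.path.d_d _ _ _)⟩
  · rw [Hom.map_d, Hom.map_d, h1, Hom.map_d, map_smul]
  · rcases (show w ≤ i by omega).lt_or_eq with hw | hw
    · rw [h2 hw, map_zero]
    · exact (mem_cycles hij).1 (h3 hw)

end WeightSpace

/-! ### Cohomology of the weight spaces -/

/-- Every cocycle of degree `i` is the starting point of a closed path of weight `i`. -/
theorem exists_mem_weightSpace_of_mem_cycles {σ : P ⟶ P} {q : kˣ} {n : ℕ} {i : ℤ} {x : P.X n i}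
    (hx : x ∈ P.cycles n i)
    (hσ : (Hom.toHom σ).map n i x - ((q ^ i : kˣ) : k) • x ∈ P.boundaries n i) :
    ∃ γ ∈ weightSpace σ q i n i, γ ∈ P.path.cycles n i ∧
      (Hom.toHom (P.pathEval 0)).map n i γ = x := by
  obtain ⟨y, hy⟩ := hσ
  have hq : ((q ^ i : kˣ) : k) ≠ 0 := Units.ne_zero _
  -- With σ x = q^i x + d y, the path is x + d(s q^{-i} y), running from x to x + q^{-i} d y =
  -- q^{-i} σ x.
  have hγ : P.pathMk (Finsupp.single 0 x + Finsupp.single 1 (P.d (sub_add_cancel i 1)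
      (((q ^ i : kˣ) : k)⁻¹ • y))) (Finsupp.single 0 (((q ^ i : kˣ) : k)⁻¹ • y)) ∈
      P.path.cycles n i := by
    rw [mem_cycles rfl] at hx
    refine pathMk_mem_cycles.2 ⟨?_, ?_⟩
    · rw [map_add]
      simp only [Finsupp.mapRange.linearMap_apply, Finsupp.mapRange_single, hx, P.d_d,
        Finsupp.single_zero, add_zero]
    · simp
  refine ⟨_, (mem_weightSpace σ q).2 ⟨?_, fun h => absurd h (lt_irrefl _), fun _ => hγ⟩, hγ, ?_⟩
  · rw [pathEval_pathMk, pathEval_pathMk, map_add (evalAt (0 : k)), map_add (evalAt (1 : k))]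
    simp only [evalAt_single, zero_pow one_ne_zero, zero_smul, pow_zero, one_pow, one_smul,
      add_zero, map_smul, hy, smul_add, smul_smul, zero_mul, one_mul, mul_inv_cancel₀ hq]
    abel_nf
  · rw [pathEval_pathMk]
    simp

/-- Makes σ - q^j invertible on H^i for i ≠ j; this is where q not being a root of unity enters. -/
theorem zpow_sub_zpow_ne_zero {q : kˣ} (hq : ∀ n : ℕ, 0 < n → q ^ n ≠ 1) {i j : ℤ}
    (h : i ≠ j) : ((q ^ i : kˣ) : k) - ((q ^ j : kˣ) : k) ≠ 0 := by
  have hinj : Function.Injective fun n : ℤ => q ^ n := by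
    rw [injective_zpow_iff_not_isOfFinOrder, isOfFinOrder_iff_pow_eq_one]
    rintro ⟨n, hn, e⟩
    exact hq n hn e
  exact sub_ne_zero.2 fun e => h (hinj (Units.ext e))

/-- The starting point of a closed path of weight `w` is a coboundary in degrees other
than `w`. -/
theorem pathEval_zero_mem_boundaries [CharZero k] {σ : P ⟶ P} {q : kˣ}
    (hσ : ∀ (n : ℕ) (i : ℤ), ∀ x ∈ P.cycles n i,
      (Hom.toHom σ).map n i x - ((q ^ i : kˣ) : k) • x ∈ P.boundaries n i)
    (hq : ∀ n : ℕ, 0 < n → q ^ n ≠ 1) {w : ℤ} {n : ℕ} {i : ℤ} (hi : i ≠ w)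
    {γ : P.path.X n i} (hw : γ ∈ weightSpace σ q w n i) (hγ : γ ∈ P.path.cycles n i) :
    (Hom.toHom (P.pathEval 0)).map n i γ ∈ P.boundaries n i := by
  -- Let x = γ(0). Modulo coboundaries σ x is q^i x by assumption, and also q^w γ(1), hence q^w x
  -- since γ is closed. So (q^w - q^i) x is a coboundary.
  have hx := hσ n i _ ((P.pathEval 0).map_mem_cycles hγ)
  rw [hw.1] at hx
  obtain ⟨a, b, rfl⟩ := pathMk_surjective γ
  rw [pathEval_pathMk, pathEval_pathMk, evalAt_one_eq hγ, smul_add, add_sub_right_comm,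
    ← sub_smul] at hx
  have hd := d_mem_boundaries (sub_add_cancel i 1) (evalAt (1 : k) (formalIntegral (k := k) b))
  have := (add_mem_cancel_right (Submodule.smul_mem _ _ hd)).1 hx
  exact (Submodule.smul_mem_iff _ (zpow_sub_zpow_ne_zero hq hi.symm)).1 this

/-- A closed path of weight `w` and degree at most `w` is a coboundary if its starting point
is. -/
theorem exists_weightSpace_d_eq [CharZero k] {σ : P ⟶ P} {q : kˣ}
    (hσ : ∀ (n : ℕ) (i : ℤ), ∀ x ∈ P.cycles n i,
      (Hom.toHom σ).map n i x - ((q ^ i : kˣ) : k) • x ∈ P.boundaries n i)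
    (hq : ∀ n : ℕ, 0 < n → q ^ n ≠ 1) {w : ℤ} {n : ℕ} {i : ℤ} (hi : i ≤ w)
    {γ : P.path.X n i} (hw : γ ∈ weightSpace σ q w n i) (hγ : γ ∈ P.path.cycles n i)
    (h0 : (Hom.toHom (P.pathEval 0)).map n i γ ∈ P.boundaries n i) :
    ∃ γ' ∈ weightSpace σ q w n (i - 1), P.path.d (sub_add_cancel i 1) γ' = γ := by
  have hw1 := hw.1
  obtain ⟨a, b, rfl⟩ := pathMk_surjective γ
  rw [pathEval_pathMk] at h0
  rw [pathEval_pathMk, pathEval_pathMk, evalAt_one_eq hγ] at hw1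
  obtain ⟨u, hu⟩ := h0
  have hqw : ((q ^ w : kˣ) : k) ≠ 0 := Units.ne_zero _
  -- The bound i ≤ w is needed here: for i = w + 1 the scalar r below would vanish, which is the
  -- spurious class removed by truncation.
  have hr := zpow_sub_zpow_ne_zero hq (show i - 1 ≠ w by omega)
  set Q : k := ((q ^ w : kˣ) : k)
  set r : k := ((q ^ (i - 1) : kˣ) : k) - Q
  set I := evalAt (1 : k) (formalIntegral (k := k) b)
  set s := (Hom.toHom σ).map n (i - 1)
  -- the obstruction to closing up the primitive of the path that starts at `u`
  set e := s u - Q • u - Q • I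
  have he : P.d (sub_add_cancel i 1) e = 0 := by
    simp only [e, s, map_sub, map_smul, ← Hom.map_d σ, hu, hw1, I]
    rw [smul_add]
    abel
  -- As σ e = q^(i-1) e + d y, subtracting r⁻¹ e from u cancels the obstruction up to the coboundary
  -- of t = -r⁻¹ y.
  obtain ⟨y, hy⟩ := hσ n (i - 1) e ((mem_cycles (sub_add_cancel i 1)).2 he)
  set t := -(r⁻¹ • y)
  have hu' : s (u - r⁻¹ • e) = Q • (u - r⁻¹ • e + I) + P.d (sub_add_cancel (i - 1) 1) t := by
    have h2 : s e = r • e + Q • e + P.d (sub_add_cancel (i - 1) 1) y := by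
      rw [hy, ← add_smul]
      simp [r, s]
    have h3 : s u = e + Q • u + Q • I := by
      simp only [e]
      abel
    rw [map_sub, map_smul, h2, h3]
    simp only [t, map_neg, map_smul, smul_add, smul_sub, smul_smul, inv_mul_cancel₀ hr, one_smul,
      mul_comm Q]
    abel
  -- The primitive is (u - r⁻¹ e) + ∫ b + d(s Q⁻¹ t). The last term is closed, vanishes at s = 0 and
  -- contributes Q⁻¹ d t at s = 1, which absorbs the remaining coboundary.
  refine ⟨P.pathMk (Finsupp.single 0 (u - r⁻¹ • e) + formalIntegral (k := k) b +
      Finsupp.single 1 (P.d (sub_add_cancel (i - 1) 1) (Q⁻¹ • t))) (Finsupp.single 0 (Q⁻¹ • t)),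
    ⟨?_, fun h => absurd h (by omega), fun h => absurd h (by omega)⟩, ?_⟩
  · rw [pathEval_pathMk, pathEval_pathMk, map_add (evalAt (0 : k)), map_add (evalAt (0 : k)),
      map_add (evalAt (1 : k)), map_add (evalAt (1 : k)), evalAt_zero_formalIntegral]
    simp only [evalAt_single, pow_zero, one_smul, zero_pow one_ne_zero, zero_smul, add_zero,
      one_pow]
    refine hu'.trans ?_
    simp only [I, Q, map_smul, smul_add, smul_smul, mul_inv_cancel₀ hqw, one_smul]
  · rw [d_pathMk]
    congr 1
    · rw [map_add, map_add, formalIntegral_mapRange_d hγ]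
      simp only [Finsupp.mapRange.linearMap_apply, Finsupp.mapRange_single, map_sub, map_smul, he,
        hu, P.d_d, smul_zero, sub_zero, Finsupp.single_zero, add_zero, add_sub_cancel]
    · rw [map_add, map_add, formalDeriv_formalIntegral]
      simp

/-! ### The operad of weighted paths -/

/-- The dg operad of finite sums of paths of all weights. -/
noncomputable def weightOperad (σ : P ⟶ P) (q : kˣ) : DGOperad.{v} k :=
  (P.path.polynomial ℤ).suboperad
    (fun n i => ⨅ w, (weightSpace σ q w n i).comap (coeff w))
    (fun τ x hx => by
      rw [Submodule.mem_iInf] at hx ⊢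
      intro w
      exact act_mem_weightSpace σ q τ (hx w))
    (by
      rw [Submodule.mem_iInf]
      intro w
      rw [Submodule.mem_comap]
      by_cases h : w = 0
      · rw [h, coeff_zero_one]
        exact one_mem_weightSpace σ q
      · rw [coeff_one_of_ne h]
        exact zero_mem _)
    (fun hp hd a f g hf hg => by
      rw [Submodule.mem_iInf] at hf hg ⊢
      exact convolution_apply_mem (P.path.comp hp hd a) (fun w => weightSpace σ q w _ _) f g
        fun w w' => comp_mem_weightSpace σ q hp hd a (hf w) (hg w'))
    (fun h x hx => by
      rw [Submodule.mem_iInf] at hx ⊢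
      intro w
      exact d_mem_weightSpace σ q h (hx w))

variable {σ : P ⟶ P} {q : kˣ}

/-- The component of weight `w`. -/
noncomputable def weightPart (w : ℤ) {n : ℕ} {i : ℤ} :
    (weightOperad σ q).X n i →ₗ[k] P.path.X n i :=
  coeff w ∘ₗ Submodule.subtype _

theorem weightPart_mem (w : ℤ) {n : ℕ} {i : ℤ} (f : (weightOperad σ q).X n i) :
    weightPart w f ∈ weightSpace σ q w n i :=
  (Submodule.mem_iInf _).1 f.2 w

theorem weightPart_d (w : ℤ) {n : ℕ} {i j : ℤ} (h : i + 1 = j) (f : (weightOperad σ q).X n i) :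
    weightPart w ((weightOperad σ q).d h f) = P.path.d h (weightPart w f) := rfl

theorem weightPart_act (w : ℤ) {n : ℕ} {i : ℤ} (τ : Equiv.Perm (Fin n))
    (f : (weightOperad σ q).X n i) :
    weightPart w ((weightOperad σ q).act τ f) = P.path.act τ (weightPart w f) := rfl

theorem weightPart_ext {n : ℕ} {i : ℤ} {f g : (weightOperad σ q).X n i}
    (h : ∀ w, weightPart w f = weightPart w g) : f = g :=
  Subtype.ext (Finsupp.ext h)

/-- An operation is determined by its components. -/
theorem exists_weightPart_eq {n : ℕ} {i : ℤ} (s : Finset ℤ) (γ : ℤ → P.path.X n i)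
    (hs : ∀ w, γ w ≠ 0 → w ∈ s) (h : ∀ w, γ w ∈ weightSpace σ q w n i) :
    ∃ f : (weightOperad σ q).X n i, ∀ w, weightPart w f = γ w :=
  ⟨⟨Finsupp.onFinset s γ hs, (Submodule.mem_iInf _).2 h⟩, fun _ => rfl⟩

theorem exists_finset_weightPart {n : ℕ} {i : ℤ} (f : (weightOperad σ q).X n i) :
    ∃ s : Finset ℤ, ∀ w, weightPart w f ≠ 0 → w ∈ s :=
  ⟨Finsupp.support f.1, fun _ h => Finsupp.mem_support_iff.2 h⟩

theorem weightPart_mem_cycles (w : ℤ) {n : ℕ} {i : ℤ} {f : (weightOperad σ q).X n i}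
    (h : f ∈ (weightOperad σ q).cycles n i) : weightPart w f ∈ P.path.cycles n i := by
  rw [mem_cycles rfl] at h ⊢
  rw [← weightPart_d, h, map_zero]

theorem mem_cycles_of_weightPart {n : ℕ} {i : ℤ} {f : (weightOperad σ q).X n i}
    (h : ∀ w, weightPart w f ∈ P.path.cycles n i) : f ∈ (weightOperad σ q).cycles n i := by
  rw [mem_cycles rfl]
  refine weightPart_ext fun w => ?_
  rw [weightPart_d, map_zero]
  exact (mem_cycles rfl).1 (h w)

/-- Components of weight below the degree are zero, so in the sum over w + w' = i + j only w = i, w'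
= j survives. This makes the projection to weight = degree multiplicative. -/
theorem weightPart_comp {m n p : ℕ} {i j l : ℤ} (hp : m + n = p + 1) (hd : i + j = l)
    (a : Fin m) (f : (weightOperad σ q).X m i) (g : (weightOperad σ q).X n j) :
    weightPart l ((weightOperad σ q).comp hp hd a f g) =
      P.path.comp hp hd a (weightPart i f) (weightPart j g) := by
  subst hd
  refine convolution_apply_eq (P.path.comp hp rfl a) f.1 g.1 i j fun w w' h hne => ?_
  have hf := (weightPart_mem w f).2.1
  have hg := (weightPart_mem w' g).2.1
  rcases lt_trichotomy w i with hw | hw | hw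
  · refine absurd ?_ hne
    exact (congrArg (P.path.comp hp rfl a · _) (hf hw)).trans (by simp)
  · exact ⟨hw, by omega⟩
  · refine absurd ?_ hne
    exact (congrArg (P.path.comp hp rfl a _) (hg (by omega))).trans (map_zero _)

/-- A cocycle is a coboundary as soon as the starting point of its component of weight equal to
the degree is. -/
theorem mem_boundaries_weightOperad [CharZero k]
    (hσ : ∀ (n : ℕ) (i : ℤ), ∀ x ∈ P.cycles n i,
      (Hom.toHom σ).map n i x - ((q ^ i : kˣ) : k) • x ∈ P.boundaries n i)
    (hq : ∀ n : ℕ, 0 < n → q ^ n ≠ 1) {n : ℕ} {i : ℤ} {f : (weightOperad σ q).X n i}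
    (hf : f ∈ (weightOperad σ q).cycles n i)
    (h0 : (Hom.toHom (P.pathEval 0)).map n i (weightPart i f) ∈ P.boundaries n i) :
    f ∈ (weightOperad σ q).boundaries n i := by
  -- Primitives are chosen weight by weight; the last clause keeps the family finitely supported.
  have key : ∀ w, ∃ γ ∈ weightSpace σ q w n (i - 1),
      P.path.d (sub_add_cancel i 1) γ = weightPart w f ∧ (weightPart w f = 0 → γ = 0) := by
    intro w
    by_cases h : weightPart w f = 0
    · exact ⟨0, zero_mem _, by rw [h, map_zero], fun _ => rfl⟩
    · have hw : i ≤ w := by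
        by_contra! hw
        exact h ((weightPart_mem w f).2.1 hw)
      obtain ⟨γ, h1, h2⟩ := exists_weightSpace_d_eq hσ hq hw (weightPart_mem w f)
        (weightPart_mem_cycles w hf) (by
          by_cases hi : i = w
          · exact hi ▸ h0
          · exact pathEval_zero_mem_boundaries hσ hq hi (weightPart_mem w f)
              (weightPart_mem_cycles w hf))
      exact ⟨γ, h1, h2, fun h' => absurd h' h⟩
  choose γ h1 h2 h3 using key
  obtain ⟨s, hs⟩ := exists_finset_weightPart f
  obtain ⟨g, hg⟩ := exists_weightPart_eq s γ (fun w hw => hs w fun h => hw (h3 w h)) h1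
  refine (mem_boundaries (sub_add_cancel i 1)).2 ⟨g, weightPart_ext fun w => ?_⟩
  rw [weightPart_d, hg, h2]

/-! ### The two quasi-isomorphisms -/

/-- The quasi-isomorphism from weighted paths to `P`: the starting point. -/
noncomputable def weightToOperad (σ : P ⟶ P) (q : kˣ) : weightOperad σ q ⟶ P :=
  Hom.mk
    { map := fun _ _ => Submodule.subtype _
      map_act := fun _ _ => rfl
      map_one := rfl
      map_comp := fun _ _ _ _ _ => rfl }
    -- The trivial character `1` adds up the components of all weights.
    (fun _ _ => rfl) ≫ P.path.polynomialEval 1 ≫ P.pathEval 0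

theorem weightToOperad_map {n : ℕ} {i : ℤ} (f : (weightOperad σ q).X n i) :
    ∃ s : Finset ℤ, (∀ w, weightPart w f ≠ 0 → w ∈ s) ∧
      (Hom.toHom (weightToOperad σ q)).map n i f =
        ∑ w ∈ s, (Hom.toHom (P.pathEval 0)).map n i (weightPart w f) := by
  refine ⟨Finsupp.support f.1, fun _ h => Finsupp.mem_support_iff.2 h, ?_⟩
  rw [← map_sum]
  refine congrArg ((Hom.toHom (P.pathEval 0)).map n i) ?_
  refine (Finsupp.lsum_apply k _ _).trans (Finset.sum_congr rfl fun w _ => ?_)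
  exact one_smul k _

theorem exists_weightOperad_cycle {n : ℕ} {i : ℤ} {x : P.X n i} (hx : x ∈ P.cycles n i)
    (hσ : (Hom.toHom σ).map n i x - ((q ^ i : kˣ) : k) • x ∈ P.boundaries n i) :
    ∃ f ∈ (weightOperad σ q).cycles n i,
      (Hom.toHom (P.pathEval 0)).map n i (weightPart i f) = x ∧
      ∀ w, w ≠ i → weightPart w f = 0 := by
  obtain ⟨γ, h1, h2, h3⟩ := exists_mem_weightSpace_of_mem_cycles hx hσ
  obtain ⟨f, hf⟩ := exists_weightPart_eq (σ := σ) (q := q) {i}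
    (fun w => if w = i then γ else 0)
    (fun w hw => by
      rw [Finset.mem_singleton]
      by_contra h
      exact hw (if_neg h))
    (fun w => by
      split_ifs with h
      · exact h ▸ h1
      · exact zero_mem _)
  refine ⟨f, mem_cycles_of_weightPart fun w => ?_, ?_, fun w hw => ?_⟩
  · rw [hf]
    split_ifs
    · exact h2
    · exact zero_mem _
  · rw [hf, if_pos rfl, h3]
  · rw [hf, if_neg hw]

theorem quasiIso_weightToOperad [CharZero k]
    (hσ : ∀ (n : ℕ) (i : ℤ), ∀ x ∈ P.cycles n i,
      (Hom.toHom σ).map n i x - ((q ^ i : kˣ) : k) • x ∈ P.boundaries n i)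
    (hq : ∀ n : ℕ, 0 < n → q ^ n ≠ 1) : QuasiIso (weightToOperad σ q) := by
  refine quasiIso_of_cycles _ (fun n i f hf h => ?_) fun n i x hx => ?_
  · refine mem_boundaries_weightOperad hσ hq hf ?_
    obtain ⟨s, hs, e⟩ := weightToOperad_map f
    rw [e] at h
    by_cases hi : i ∈ s
    -- The starting points in weights other than i are coboundaries anyway, so the one in weight i
    -- must be a coboundary too.
    · rw [← Finset.add_sum_erase _ _ hi] at h
      refine (add_mem_cancel_right (Submodule.sum_mem _ fun w hw => ?_)).1 h
      exact pathEval_zero_mem_boundaries hσ hq (Finset.ne_of_mem_erase hw).symm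
        (weightPart_mem w f) (weightPart_mem_cycles w hf)
    · rw [not_imp_comm.1 (hs i) hi, map_zero]
      exact zero_mem _
  · obtain ⟨f, hf, h1, h2⟩ := exists_weightOperad_cycle hx (hσ n i x hx)
    refine ⟨f, hf, ?_⟩
    obtain ⟨s, hs, e⟩ := weightToOperad_map f
    rw [e, Finset.sum_eq_single i, h1]
    · intro w _ hw
      rw [h2 w hw, map_zero]
    · intro hi
      rw [not_imp_comm.1 (hs i) hi, map_zero]

/-- The starting point of the component of weight equal to the degree. -/
noncomputable def startingCycle {n : ℕ} {i : ℤ} :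
    (weightOperad σ q).X n i →ₗ[k] P.cycles n i :=
  ((Hom.toHom (P.pathEval 0)).map n i ∘ₗ weightPart i).codRestrict _ fun f =>
    (P.pathEval 0).map_mem_cycles ((weightPart_mem i f).2.2 rfl)

theorem coe_startingCycle {n : ℕ} {i : ℤ} (f : (weightOperad σ q).X n i) :
    (startingCycle f : P.X n i) = (Hom.toHom (P.pathEval 0)).map n i (weightPart i f) := rfl

/-- The quasi-isomorphism from weighted paths to `H(P)`: the class of the starting point of the
component of weight equal to the degree. -/
noncomputable def weightToHomology (σ : P ⟶ P) (q : kˣ) :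
    weightOperad σ q ⟶ P.homology.toDGOperad :=
  Hom.mk
    { map := fun _ _ => H.mk ∘ₗ startingCycle
      map_act := fun τ f => congrArg H.mk (Subtype.ext (by
        rw [coe_startingCycle, weightPart_act, GradedOperad.Hom.map_act]
        rfl))
      map_one := congrArg H.mk (Subtype.ext (by
        rw [coe_startingCycle]
        exact (congrArg _ coeff_zero_one).trans (GradedOperad.Hom.map_one _)))
      map_comp := fun hp hd a f g => congrArg H.mk (Subtype.ext (by
        rw [coe_startingCycle, weightPart_comp, GradedOperad.Hom.map_comp]
        rfl)) }
    (fun h f => by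
      refine H.mk_eq_zero.2 ?_
      rw [coe_startingCycle, weightPart_d, Hom.map_d]
      exact d_mem_boundaries _ _)

/-- The target has zero differential, so a cocycle sent to a coboundary is sent to zero: its weight
i component starts at a coboundary, which is the criterion of `mem_boundaries_weightOperad`. -/
theorem quasiIso_weightToHomology [CharZero k]
    (hσ : ∀ (n : ℕ) (i : ℤ), ∀ x ∈ P.cycles n i,
      (Hom.toHom σ).map n i x - ((q ^ i : kˣ) : k) • x ∈ P.boundaries n i)
    (hq : ∀ n : ℕ, 0 < n → q ^ n ≠ 1) : QuasiIso (weightToHomology σ q) := by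
  refine quasiIso_of_cycles _ (fun n i f hf h => ?_) fun n i x _ => ?_
  · obtain ⟨y, hy⟩ := h
    exact mem_boundaries_weightOperad hσ hq hf (H.mk_eq_zero.1 hy.symm)
  · change P.H n i at x
    induction x using H.ind with | h x =>
    obtain ⟨f, hf, h1, -⟩ := exists_weightOperad_cycle x.2 (hσ n i x.1 x.2)
    exact ⟨f, hf, congrArg H.mk (Subtype.ext h1)⟩

end DGOperad

end Operadic

theorem mainTheorem2 {k : Type u} [Field k] [CharZero k]
    (P : Operadic.DGOperad.{max u v} k)
    (h0 : ∀ i : ℤ, Subsingleton (P.homology.X 0 i))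
    (h1 : Nonempty (P.homology.X 1 0 ≃ₗ[k] k))
    (h1' : ∀ i : ℤ, i ≠ 0 → Subsingleton (P.homology.X 1 i))
    (q : kˣ) (hq : ∀ n : ℕ, 0 < n → q ^ n ≠ 1)
    (σ : P ≅ P)
    (hσ : (Operadic.DGOperad.homologyFunctor k).mapIso σ = P.homology.gradingAut q) :
    P.Formal := by
  have key : ∀ (n : ℕ) (i : ℤ), ∀ x ∈ P.cycles n i,
      (Operadic.DGOperad.Hom.toHom σ.hom).map n i x - ((q ^ i : kˣ) : k) • x ∈
        P.boundaries n i := by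
    intro n i x hx
    -- Evaluating the equality of automorphisms at the class of x turns it into a congruence of
    -- cocycles modulo coboundaries.
    have := congrArg (fun φ => Operadic.GradedOperad.Hom.map (Iso.hom φ) n i
      (Operadic.DGOperad.H.mk ⟨x, hx⟩)) hσ
    exact (Operadic.DGOperad.H.mk_eq_mk (y := ((q ^ i : kˣ) : k) • ⟨x, hx⟩)).1 this
  exact .trans _ _ _
    (.symm _ _ (.rel _ _ ⟨_, Operadic.DGOperad.quasiIso_weightToOperad key hq⟩))
    (.rel _ _ ⟨_, Operadic.DGOperad.quasiIso_weightToHomology key hq⟩)
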